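/- **Topological representation theorem for U-rich EDC-lattices.** An *extended distributive contact lattice* (EDC-lattice) is a bounded distributive lattice $(D,\le,0,1,+,\cdot)$ with three binary relations $C$ (contact), $\widehat C$ (dual contact), $\ll$ (nontangential part-of) satisfying the following axioms, where $\overline R$ denotes the complement of a relation $R$. For $C$: (C1) $aCb\Rightarrow a\ne0$ and $b\neq 0$; (C2) $aCb$, $a\le a'$, $b\le b'\Rightarrow a'Cb'$; (C3) $aC(b+c)\Rightarrow aCb$ or $aCc$; (C4) $aCb\Rightarrow bCa$; (C5) $a\cdot b\ne0\Rightarrow aCb$. For $\widehat C$: $a\widehat Cb\Rightarrow a\neq 1$ and $b\ne1$; $a\widehat Cb$, $a'\le a$, $b'\le b\Rightarrow a'\widehat Cb'$; $a\widehat C(b\cdot c)\Rightarrow a\widehat Cb$ or $a\widehat Cc$; $a\widehat Cb\Rightarrow b\widehat Ca$; $a+b\ne1\Rightarrow a\widehat Cb$. For $\ll$: $0\ll0$; $1\ll1$; $a\ll b\Rightarrow a\le b$; $a'\le a\ll b\le b'\Rightarrow a'\ll b'$; $a\ll c$, $b\ll c\Rightarrow a+b\ll c$; $c\ll a$, $c\ll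 b\Rightarrow c\ll a\cdot b$; $a\ll b$, $b\cdot c\ll d$, $c\ll a+d\Rightarrow c\ll d$. Mixed: $aCb$, $a\ll c\Rightarrow aC(b\cdot c)$; $a\overline C(b\cdot c)$, $aCb$, $(a\cdot d)\overline Cb\Rightarrow d\widehat Cc$; $a\widehat Cb$, $c\ll a\Rightarrow a\widehat C(b+c)$; $a\overline{\widehat C}(b+c)$, $a\widehat Cb$, $(a+d)\overline{\widehat C}b\Rightarrow dCc$; $a\overline{\widehat C}b$, $a\cdot c\ll b\Rightarrow c\ll b$; $a\overline Cb$, $b\ll a+c\Rightarrow b\ll c$. An EDC-lattice is *U-rich* if it satisfies * (Ext $\widehat O$) $a\not\le b\Rightarrow\exists c\,(a+c=1$ and $b+c\ne1)$; * (U-rich $\ll$) $a\ll b\Rightarrow\exists c\,(b+c=1$ and $a\overline Cc)$; * (U-rich $\widehat C$) $a\overline{\widehat C}b\Rightarrow\exists c,d\,(a+c=1,\ b+d=1$ and $c\overline Cd)$. Consider also the axioms * (Ext C) $a\ne1\Rightarrow\exists b\ne0\,(a\overline Cb)$; * (Con C) $a\ne0$, $b\ne0$, $a+b=1\Rightarrow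 aCb$; * (Nor 1) $a\overline Cb\Rightarrow\exists c,d\,(c+d=1,\ a\overline Cc$ and $b\overline Cd)$. For a topological space $X$, $RC(X)$ is the Boolean algebra of regular closed sets ($a=\mathrm{Cl}(\mathrm{Int}\,a)$), ordered by inclusion, with $a+b=a\cup b$, $a\cdot b=\mathrm{Cl}(\mathrm{Int}(a\cap b))$, $a^*=\mathrm{Cl}(X\setminus a)$. It is an EDC-lattice with $aCb$ iff $a\cap b\neq\varnothing$, $a\widehat Cb$ iff $a^*Cb^*$, and $a\ll b$ iff $a\overline Cb^*$. An *embedding* of EDC-lattices is an injective homomorphism of bounded lattices that preserves and reflects the three relations. An embedding $h:D\to RC(X)$ is *dually dense* if every $\alpha\ne1$ in $RC(X)$ satisfies $\alpha\le h(a)\ne1$ for some $a\in D$. It is *C-separable* if for all $\alpha,\beta\in RC(X)$: if $\alpha\overline C\beta$ there are $a,b\in D$ with $\alpha\le h(a)$, $\beta\le h(b)$, $h(a)\overline Ch(b)$; if $\alpha\overline{\widehat C}\beta$ there are $a,b\in D$ with $\alpha+h(a)=1$, $\beta+h(b)=1$, $h(a)\overline Ch(b)$; and if $\alpha\ll\beta$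 there are $a,b\in D$ with $\alpha\le h(a)$, $\beta+h(b)=1$, $h(a)\overline Ch(b)$. A *clan* of $D$ is a set $\Gamma\subseteq D$ with $1\in\Gamma$, $0\notin\Gamma$, which is upward closed, such that $a+b\in\Gamma$ implies $a\in\Gamma$ or $b\in\Gamma$, and such that $aCb$ for all $a,b\in\Gamma$. Let $X$ be the set of all clans of $D$, with the topology whose closed sets are the intersections of sets of the form $h(a)=\{\Gamma\in X: a\in\Gamma\}$, $a\in D$. **Theorem.** Let $D$ be a U-rich EDC-lattice. Then $X$ is a compact semiregular (having a closed base of regular closed sets) $T_0$-space, and $h$ is a dually dense and C-separable embedding of $D$ into $RC(X)$. Moreover: 1. $D$ satisfies (Ext C) iff $RC(X)$ satisfies (Ext C); in this case $X$ is weakly regular (semiregular, and every nonempty open set contains the closure of a nonempty open set). 2. $D$ satisfies (Con C) iff $RC(X)$ satisfies (Con C); in this case $X$ is connected (not the union of two disjoint nonempty open sets). 3. $D$ satisfies (Nor 1) iff $RC(X)$ satisfies (Nor 1); in this case $X$ is $\kappa$-normal (any two disjoint regular closed sets are separated by disjoint open sets). -/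

import Mathlib

namespace Mereotopology

open Set

/-! ## Extended distributive contact lattices -/

/-- An extended distributive contact lattice (EDC-lattice): a bounded distributive lattice with
three relations `C` (contact), `dC` (dual contact) and `ll` (nontangential part-of), subject to the
axioms below. The zero, unit, sum and product of the lattice are `⊥`, `⊤`, `⊔` and `⊓`. -/
class EDCLattice (D : Type*) [DistribLattice D] [BoundedOrder D] where
  /-- contact -/
  C : D → D → Prop
  /-- dual contact -/
  dC : D → D → Prop
  /-- nontangential part-of -/
  ll : D → D → Prop
  C1 : ∀ a b, C a b → a ≠ ⊥ ∧ b ≠ ⊥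
  C2 : ∀ a b a' b', C a b → a ≤ a' → b ≤ b' → C a' b'
  C3 : ∀ a b c, C a (b ⊔ c) → C a b ∨ C a c
  C4 : ∀ a b, C a b → C b a
  C5 : ∀ a b, a ⊓ b ≠ ⊥ → C a b
  dC1 : ∀ a b, dC a b → a ≠ ⊤ ∧ b ≠ ⊤
  dC2 : ∀ a b a' b', dC a b → a' ≤ a → b' ≤ b → dC a' b'
  dC3 : ∀ a b c, dC a (b ⊓ c) → dC a b ∨ dC a c
  dC4 : ∀ a b, dC a b → dC b a
  dC5 : ∀ a b, a ⊔ b ≠ ⊤ → dC a b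
  ll1 : ll ⊥ ⊥
  ll2 : ll ⊤ ⊤
  ll3 : ∀ a b, ll a b → a ≤ b
  ll4 : ∀ a b a' b', a' ≤ a → ll a b → b ≤ b' → ll a' b'
  ll5 : ∀ a b c, ll a c → ll b c → ll (a ⊔ b) c
  ll6 : ∀ a b c, ll c a → ll c b → ll c (a ⊓ b)
  ll7 : ∀ a b c d, ll a b → ll (b ⊓ c) d → ll c (a ⊔ d) → ll c d
  MC1 : ∀ a b c, C a b → ll a c → C a (b ⊓ c)
  MC2 : ∀ a b c d, ¬ C a (b ⊓ c) → C a b → ¬ C (a ⊓ d) b → dC d c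
  MdC1 : ∀ a b c, dC a b → ll c a → dC a (b ⊔ c)
  MdC2 : ∀ a b c d, ¬ dC a (b ⊔ c) → dC a b → ¬ dC (a ⊔ d) b → C d c
  Mll1 : ∀ a b c, ¬ dC a b → ll (a ⊓ c) b → ll c b
  Mll2 : ∀ a b c, ¬ C a b → ll b (a ⊔ c) → ll b c

/-- A contact algebra: a Boolean algebra with a contact relation. -/
class ContactAlgebra (B : Type*) [BooleanAlgebra B] where
  /-- contact -/
  C : B → B → Prop
  C1 : ∀ a b, C a b → a ≠ ⊥ ∧ b ≠ ⊥
  C2 : ∀ a b a' b', C a b → a ≤ a' → b ≤ b' → C a' b'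
  C3 : ∀ a b c, C a (b ⊔ c) → C a b ∨ C a c
  C4 : ∀ a b, C a b → C b a
  C5 : ∀ a b, a ⊓ b ≠ ⊥ → C a b

namespace ContactAlgebra

variable {B : Type*} [BooleanAlgebra B] [ContactAlgebra B]

theorem split_right {a b : B} (c : B) (h : C a b) : C a (b ⊓ c) ∨ C a (b ⊓ cᶜ) := by
  apply C3
  rwa [← inf_sup_left, sup_compl_eq_top, inf_top_eq]

theorem split_left {a b : B} (c : B) (h : C a b) : C (a ⊓ c) b ∨ C (a ⊓ cᶜ) b :=
  (split_right c (C4 _ _ h)).imp (C4 _ _) (C4 _ _)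

theorem sup_left {a b c : B} (h : C (a ⊔ b) c) : C a c ∨ C b c :=
  (C3 _ _ _ (C4 _ _ h)).imp (C4 _ _) (C4 _ _)

/-- Every contact algebra is an EDC-lattice, with `a` and `b` in dual contact when `aᶜ` and `bᶜ`
are in contact, and `a` a nontangential part of `b` when `a` and `bᶜ` are not in contact. -/
instance toEDCLattice : EDCLattice B where
  C a b := C a b
  dC a b := C aᶜ bᶜ
  ll a b := ¬ C a bᶜ
  C1 := C1
  C2 := C2
  C3 := C3
  C4 := C4
  C5 := C5
  dC1 a b h := by simpa using C1 _ _ h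
  dC2 a b a' b' h ha hb := C2 _ _ _ _ h (compl_le_compl ha) (compl_le_compl hb)
  dC3 a b c h := C3 _ _ _ (by rwa [compl_inf] at h)
  dC4 a b h := C4 _ _ h
  dC5 a b h := C5 _ _ (by rwa [← compl_sup, ne_eq, compl_eq_bot])
  ll1 h := (C1 _ _ h).1 rfl
  ll2 h := (C1 _ _ h).2 compl_top
  ll3 a b h := by
    by_contra hab
    exact h (C5 _ _ fun h0 => hab (by
      rwa [← disjoint_iff, disjoint_compl_right_iff] at h0))
  ll4 a b a' b' ha h hb h' := h (C2 _ _ _ _ h' ha (compl_le_compl hb))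
  ll5 a b c ha hb h := (sup_left h).elim ha hb
  ll6 a b c ha hb h := (C3 _ _ _ (by rwa [compl_inf] at h)).elim ha hb
  ll7 a b c d hab hbc hc h := by
    rcases split_left b h with h | h
    · exact hbc (by rwa [inf_comm])
    · rcases split_right a h with h | h
      · exact hab (C4 _ _ (C2 _ _ _ _ h inf_le_right inf_le_right))
      · exact hc (C2 _ _ _ _ h inf_le_left (by rw [compl_sup, inf_comm]))
  MC1 a b c h hac := (split_right c h).resolve_right
    fun h' => hac (C2 _ _ _ _ h' le_rfl inf_le_right)
  MC2 a b c d h1 h2 h3 := by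
    have h4 := (split_left d h2).resolve_left h3
    rcases split_right c h4 with h | h
    · exact (h1 (C2 _ _ _ _ h inf_le_left le_rfl)).elim
    · exact C2 _ _ _ _ h inf_le_right inf_le_right
  MdC1 a b c h hca := by
    rw [compl_sup]
    exact (split_right c h).resolve_left
      fun h' => hca (C4 _ _ (C2 _ _ _ _ h' le_rfl inf_le_right))
  MdC2 a b c d h1 h2 h3 := by
    rw [compl_sup] at h1 h3
    rcases split_left d h2 with h4 | h4
    · rcases split_right c h4 with h | h
      · exact C2 _ _ _ _ h inf_le_right inf_le_right
      · exact (h1 (C2 _ _ _ _ h inf_le_left le_rfl)).elim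
    · exact (h3 h4).elim
  Mll1 a b c h1 h2 h := by
    rcases split_left a h with h | h
    · exact h2 (by rwa [inf_comm])
    · exact h1 (C2 _ _ _ _ h inf_le_right le_rfl)
  Mll2 a b c h1 h2 h := by
    rcases split_right a h with h | h
    · exact h1 (C4 _ _ (C2 _ _ _ _ h le_rfl inf_le_right))
    · exact h2 (by rwa [compl_sup, inf_comm])

end ContactAlgebra

/-! ## Additional axioms -/

section Axioms

variable (D : Type*) [DistribLattice D] [BoundedOrder D]

/-- Extensionality of underlap. -/
def ExtUnderlap : Prop := ∀ a b : D, ¬ a ≤ b → ∃ c, a ⊔ c = ⊤ ∧ b ⊔ c ≠ ⊤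

variable [EDCLattice D]

open EDCLattice

/-- The U-rich axiom for `≪`. -/
def URichLL : Prop := ∀ a b : D, ll a b → ∃ c, b ⊔ c = ⊤ ∧ ¬ C a c

/-- The U-rich axiom for dual contact. -/
def URichDC : Prop := ∀ a b : D, ¬ dC a b → ∃ c d, a ⊔ c = ⊤ ∧ b ⊔ d = ⊤ ∧ ¬ C c d

/-- U-rich EDC-lattices. -/
structure IsURich : Prop where
  extUnderlap : ExtUnderlap D
  uRichLL : URichLL D
  uRichDC : URichDC D

/-- C-extensionality. -/
def ExtC : Prop := ∀ a : D, a ≠ ⊤ → ∃ b, b ≠ ⊥ ∧ ¬ C a b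

/-- C-connectedness. -/
def ConC : Prop := ∀ a b : D, a ≠ ⊥ → b ≠ ⊥ → a ⊔ b = ⊤ → C a b

/-- The first normality axiom. -/
def Nor1 : Prop := ∀ a b : D, ¬ C a b → ∃ c d, c ⊔ d = ⊤ ∧ ¬ C a c ∧ ¬ C b d

end Axioms

/-! ## Embeddings -/

section Embeddings

variable (D₁ D₂ : Type*) [DistribLattice D₁] [BoundedOrder D₁] [EDCLattice D₁]
  [DistribLattice D₂] [BoundedOrder D₂] [EDCLattice D₂]

/-- An embedding of EDC-lattices: an injective homomorphism of bounded lattices that preserves and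
reflects the three relations. -/
structure EDCEmbedding extends BoundedLatticeHom D₁ D₂ where
  injective' : Function.Injective toFun
  contact_iff' : ∀ a b, EDCLattice.C (toFun a) (toFun b) ↔ EDCLattice.C a b
  dualContact_iff' : ∀ a b, EDCLattice.dC (toFun a) (toFun b) ↔ EDCLattice.dC a b
  ll_iff' : ∀ a b, EDCLattice.ll (toFun a) (toFun b) ↔ EDCLattice.ll a b

variable {D₁ D₂}

instance : CoeFun (EDCEmbedding D₁ D₂) fun _ => D₁ → D₂ := ⟨fun h => h.toFun⟩

/-- The image of `h` is a dually dense sublattice. -/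
def EDCEmbedding.IsDuallyDense (h : EDCEmbedding D₁ D₂) : Prop :=
  ∀ a₂ : D₂, a₂ ≠ ⊤ → ∃ a₁ : D₁, a₂ ≤ h a₁ ∧ h a₁ ≠ ⊤

/-- The image of `h` is a C-separable EDC-sublattice. -/
structure EDCEmbedding.IsCSeparable (h : EDCEmbedding D₁ D₂) : Prop where
  contact : ∀ a₂ b₂ : D₂, ¬ EDCLattice.C a₂ b₂ →
    ∃ a₁ b₁ : D₁, a₂ ≤ h a₁ ∧ b₂ ≤ h b₁ ∧ ¬ EDCLattice.C (h a₁) (h b₁)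
  dualContact : ∀ a₂ b₂ : D₂, ¬ EDCLattice.dC a₂ b₂ →
    ∃ a₁ b₁ : D₁, a₂ ⊔ h a₁ = ⊤ ∧ b₂ ⊔ h b₁ = ⊤ ∧ ¬ EDCLattice.C (h a₁) (h b₁)
  ll : ∀ a₂ b₂ : D₂, EDCLattice.ll a₂ b₂ →
    ∃ a₁ b₁ : D₁, a₂ ≤ h a₁ ∧ b₂ ⊔ h b₁ = ⊤ ∧ ¬ EDCLattice.C (h a₁) (h b₁)

end Embeddings

/-! ## Regular closed sets -/

section RegularClosed

variable {X : Type*} [TopologicalSpace X]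

/-- A set is regular closed if it is the closure of its interior. -/
def IsRegularClosed (s : Set X) : Prop := closure (interior s) = s

theorem IsRegularClosed.isClosed {s : Set X} (h : IsRegularClosed s) : IsClosed s :=
  h ▸ isClosed_closure

theorem isRegularClosed_closure {s : Set X} (hs : IsOpen s) : IsRegularClosed (closure s) :=
  subset_antisymm (closure_minimal interior_subset isClosed_closure)
    (closure_mono (interior_maximal subset_closure hs))

theorem IsRegularClosed.union {s t : Set X} (hs : IsRegularClosed s) (ht : IsRegularClosed t) :
    IsRegularClosed (s ∪ t) := by
  refine subset_antisymm (closure_minimal interior_subset (hs.isClosed.union ht.isClosed)) ?_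
  refine union_subset ?_ ?_
  · exact hs.symm.subset.trans (closure_mono (interior_mono subset_union_left))
  · exact ht.symm.subset.trans (closure_mono (interior_mono subset_union_right))

variable (X) in
/-- The regular closed subsets of `X`. -/
@[ext]
structure RC where
  /-- the underlying set -/
  carrier : Set X
  regular : IsRegularClosed carrier

namespace RC

instance : PartialOrder (RC X) where
  le a b := a.carrier ⊆ b.carrier
  le_refl _ := subset_rfl
  le_trans _ _ _ h h' := h.trans h'
  le_antisymm _ _ h h' := RC.ext (subset_antisymm h h')

/-- The Boolean algebra of regular closed sets: the order is inclusion, the sum is the union, the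
product of `a` and `b` is the closure of the interior of `a ∩ b`, and the complement of `a` is the
closure of the set complement of `a`. -/
instance : BooleanAlgebra (RC X) where
  sup a b := ⟨a.carrier ∪ b.carrier, a.regular.union b.regular⟩
  inf a b := ⟨closure (interior (a.carrier ∩ b.carrier)), isRegularClosed_closure isOpen_interior⟩
  compl a := ⟨closure a.carrierᶜ, isRegularClosed_closure a.regular.isClosed.isOpen_compl⟩
  top := ⟨univ, by simp [IsRegularClosed]⟩
  bot := ⟨∅, by simp [IsRegularClosed]⟩
  le_sup_left a b := subset_union_left (s := a.carrier)
  le_sup_right a b := subset_union_right (s := a.carrier)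
  sup_le a b c h h' := union_subset (s := a.carrier) h h'
  inf_le_left a b := closure_minimal (interior_subset.trans inter_subset_left) a.regular.isClosed
  inf_le_right a b := closure_minimal (interior_subset.trans inter_subset_right) b.regular.isClosed
  le_inf a b c h h' :=
    a.regular.symm.subset.trans (closure_mono (interior_mono (subset_inter h h')))
  le_sup_inf a b c := by
    refine closure_minimal ?_ (a.regular.isClosed.union isClosed_closure)
    intro x hx
    by_cases hxa : x ∈ a.carrier
    · exact Or.inl hxa
    · refine Or.inr (subset_closure ?_)
      refine mem_interior.2 ⟨interior ((a.carrier ∪ b.carrier) ∩ (a.carrier ∪ c.carrier)) ∩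
        a.carrierᶜ, ?_, isOpen_interior.inter a.regular.isClosed.isOpen_compl, hx, hxa⟩
      rintro y ⟨hy, hya⟩
      have hy' := interior_subset hy
      exact ⟨hy'.1.resolve_left hya, hy'.2.resolve_left hya⟩
  inf_compl_le_bot a := by
    change closure (interior (a.carrier ∩ closure a.carrierᶜ)) ⊆ ∅
    have h : interior (a.carrier ∩ closure a.carrierᶜ) = ∅ := by
      rw [closure_compl, interior_inter, ← subset_empty_iff]
      rintro x ⟨hx, hx'⟩
      exact interior_subset hx' hx
    rw [h, closure_empty]
  top_le_sup_compl a x _ := by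
    by_cases hx : x ∈ a.carrier
    · exact Or.inl hx
    · exact Or.inr (subset_closure hx)
  le_top a := subset_univ _
  bot_le a := empty_subset _

/-- Regular closed sets are in contact when they have a common point. -/
instance : ContactAlgebra (RC X) where
  C a b := (a.carrier ∩ b.carrier).Nonempty
  C1 a b h := by
    constructor
    · rintro rfl
      exact h.some_mem.1
    · rintro rfl
      exact h.some_mem.2
  C2 a b a' b' h ha hb := h.mono (inter_subset_inter ha hb)
  C3 a b c h := by
    obtain ⟨x, hxa, hx | hx⟩ := h
    · exact Or.inl ⟨x, hxa, hx⟩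
    · exact Or.inr ⟨x, hxa, hx⟩
  C4 a b h := by rwa [inter_comm]
  C5 a b h := by
    by_contra h'
    rw [not_nonempty_iff_eq_empty] at h'
    refine h (RC.ext ?_)
    change closure (interior (a.carrier ∩ b.carrier)) = ∅
    simp [h']

end RC

end RegularClosed

/-! ## Topological properties -/

section Topology

variable (X : Type*) [TopologicalSpace X]

/-- The members of `B` are closed, and every closed set is an intersection of members of `B`. -/
def IsClosedBasis {X : Type*} [TopologicalSpace X] (B : Set (Set X)) : Prop :=
  (∀ b ∈ B, IsClosed b) ∧ ∀ F : Set X, IsClosed F → ∃ A ⊆ B, F = ⋂₀ A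

/-- A space is semiregular if it has a closed basis of regular closed sets. -/
def IsSemiregular : Prop :=
  ∃ B : Set (Set X), IsClosedBasis B ∧ ∀ b ∈ B, IsRegularClosed b

/-- A semiregular space in which every nonempty open set contains the closure of a nonempty open
set. -/
def IsWeaklyRegular : Prop :=
  IsSemiregular X ∧ ∀ a : Set X, IsOpen a → a.Nonempty →
    ∃ b : Set X, IsOpen b ∧ b.Nonempty ∧ closure b ⊆ a

/-- Disjoint regular closed sets have disjoint open neighbourhoods. -/
def IsKappaNormal : Prop :=
  ∀ a b : Set X, IsRegularClosed a → IsRegularClosed b → Disjoint a b → SeparatedNhds a b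

end Topology

/-! ## The space of clans -/

section Clans

variable (D : Type*) [DistribLattice D] [BoundedOrder D] [EDCLattice D]

/-- Clans of an EDC-lattice. -/
@[ext]
structure Clan where
  /-- the underlying set -/
  carrier : Set D
  top_mem : ⊤ ∈ carrier
  bot_notMem : ⊥ ∉ carrier
  mem_of_le : ∀ a b, a ∈ carrier → a ≤ b → b ∈ carrier
  mem_or_mem : ∀ a b, a ⊔ b ∈ carrier → a ∈ carrier ∨ b ∈ carrier
  contact : ∀ a b, a ∈ carrier → b ∈ carrier → EDCLattice.C a b

variable {D}

/-- The set of clans that contain `a`. -/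
def clansOf (a : D) : Set (Clan D) := {Γ | a ∈ Γ.carrier}

theorem clansOf_sup (a b : D) : clansOf (a ⊔ b) = clansOf a ∪ clansOf b := by
  ext Γ
  constructor
  · exact Γ.mem_or_mem a b
  · rintro (h | h)
    · exact Γ.mem_of_le _ _ h le_sup_left
    · exact Γ.mem_of_le _ _ h le_sup_right

/-- The topology on the set of clans whose closed sets are the intersections of sets
`clansOf a`. -/
instance : TopologicalSpace (Clan D) :=
  TopologicalSpace.ofClosed {F | ∃ A : Set D, F = ⋂ a ∈ A, clansOf a}
    ⟨{⊥}, by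
      ext Γ
      simpa [clansOf] using Γ.bot_notMem⟩
    (by
      intro S hS
      have hS' : ∀ F ∈ S, ∃ A : Set D, F = ⋂ a ∈ A, clansOf a := fun F hF => hS hF
      choose! A hA using hS'
      refine ⟨⋃ F ∈ S, A F, ?_⟩
      ext Γ
      simp only [mem_sInter, mem_iInter, mem_iUnion]
      constructor
      · rintro h a ⟨F, hF, ha⟩
        have := h F hF
        rw [hA F hF] at this
        exact mem_iInter₂.1 this a ha
      · intro h F hF
        rw [hA F hF]
        exact mem_iInter₂.2 fun a ha => h a ⟨F, hF, ha⟩)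
    (by
      rintro _ ⟨A, rfl⟩ _ ⟨B, rfl⟩
      refine ⟨{c | ∃ a ∈ A, ∃ b ∈ B, a ⊔ b = c}, ?_⟩
      ext Γ
      simp only [mem_union, mem_iInter]
      constructor
      · rintro (h | h) _ ⟨a, ha, b, hb, rfl⟩
        · rw [clansOf_sup]
          exact Or.inl (h a ha)
        · rw [clansOf_sup]
          exact Or.inr (h b hb)
      · intro h
        by_contra! hn
        obtain ⟨⟨a, ha, ha'⟩, b, hb, hb'⟩ := hn
        have := h _ ⟨a, ha, b, hb, rfl⟩
        rw [clansOf_sup] at this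
        exact this.elim ha' hb')

end Clans

end Mereotopology

open Mereotopology

namespace Mereotopology

open Set Order

section ClanExistence

variable {D : Type*} [DistribLattice D] [BoundedOrder D] [EDCLattice D]

theorem contact_sup_left {a b c : D} (h : EDCLattice.C (a ⊔ b) c) :
    EDCLattice.C a c ∨ EDCLattice.C b c :=
  (EDCLattice.C3 _ _ _ (EDCLattice.C4 _ _ h)).imp (EDCLattice.C4 _ _) (EDCLattice.C4 _ _)

theorem not_contact_bot_left (a : D) : ¬ EDCLattice.C ⊥ a := fun h => (EDCLattice.C1 _ _ h).1 rfl

theorem not_contact_bot_right (a : D) : ¬ EDCLattice.C a ⊥ := fun h => (EDCLattice.C1 _ _ h).2 rfl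

/-- An ideal avoiding an element extends to a prime ideal avoiding that element. -/
theorem exists_prime_ideal_notMem {L : Type*} [DistribLattice L] (I : Ideal L) {a : L} (ha : a ∉ I) :
    ∃ J : Ideal L, J.IsPrime ∧ I ≤ J ∧ a ∉ J := by
  obtain ⟨J, hJ, hIJ, hd⟩ := DistribLattice.prime_ideal_of_disjoint_filter_ideal
    (F := PFilter.principal a) (I := I) (by
      rw [Set.disjoint_left]
      intro x hx hxI
      exact ha (I.lower (PFilter.mem_principal.1 hx) hxI))
  exact ⟨J, hJ, hIJ, fun h => Set.disjoint_left.1 hd (PFilter.mem_principal.2 le_rfl) h⟩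

theorem contact_of_notMem_prime (J : Ideal D) {x y : D} (hJ : J.IsPrime) (hx : x ∉ J) (hy : y ∉ J) :
    EDCLattice.C x y :=
  EDCLattice.C5 _ _ fun h => (hJ.mem_or_mem (x := x) (y := y) (h ▸ J.bot_mem)).elim hx hy

/-- The union of the complements of two prime ideals is a clan when these complements are
elementwise in contact. -/
def Clan.ofPrimeIdeals (J K : Ideal D) (hJ : J.IsPrime) (hK : K.IsPrime)
    (h : ∀ x ∉ J, ∀ y ∉ K, EDCLattice.C x y) : Clan D where
  carrier := {x | x ∉ J ∨ x ∉ K}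
  top_mem := Or.inl fun h => hJ.ne_univ (Set.eq_univ_of_forall fun _ => J.lower le_top h)
  bot_notMem := by simp
  mem_of_le a b ha hab := ha.imp (fun h h' => h (J.lower hab h')) (fun h h' => h (K.lower hab h'))
  mem_or_mem a b hab := by
    simp only [mem_ofPred_eq, Ideal.sup_mem_iff] at hab ⊢
    tauto
  contact a b := by
    rintro (ha | ha) (hb | hb)
    · exact contact_of_notMem_prime J hJ ha hb
    · exact h a ha b hb
    · exact EDCLattice.C4 _ _ (h b hb a ha)
    · exact contact_of_notMem_prime K hK ha hb

/-- Elements in contact belong to a common clan. -/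
theorem exists_clan_of_contact {a b : D} (h : EDCLattice.C a b) :
    ∃ Γ : Clan D, a ∈ Γ.carrier ∧ b ∈ Γ.carrier := by
  let I : Ideal D := ⟨⟨{x | ¬ EDCLattice.C x b}, fun x y hyx hx hy =>
      hx (EDCLattice.C2 _ _ _ _ hy hyx le_rfl)⟩, ⟨⊥, not_contact_bot_left b⟩,
    fun x hx y hy => ⟨x ⊔ y, fun h => (contact_sup_left h).elim hx hy, le_sup_left, le_sup_right⟩⟩
  obtain ⟨J, hJ, hIJ, haJ⟩ := exists_prime_ideal_notMem I (a := a) (fun h' => h' h)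
  let I' : Ideal D := ⟨⟨{y | ∃ x ∉ J, ¬ EDCLattice.C x y}, by
      rintro y z hzy ⟨x, hx, hxy⟩
      exact ⟨x, hx, fun h => hxy (EDCLattice.C2 _ _ _ _ h le_rfl hzy)⟩⟩,
    ⟨⊥, a, haJ, not_contact_bot_right a⟩, by
      rintro y ⟨x, hx, hxy⟩ z ⟨w, hw, hwz⟩
      refine ⟨y ⊔ z, ⟨x ⊓ w, fun h => (hJ.mem_or_mem h).elim hx hw, fun h => ?_⟩,
        le_sup_left, le_sup_right⟩
      rcases EDCLattice.C3 _ _ _ h with h | h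
      · exact hxy (EDCLattice.C2 _ _ _ _ h inf_le_left le_rfl)
      · exact hwz (EDCLattice.C2 _ _ _ _ h inf_le_right le_rfl)⟩
  obtain ⟨K, hK, hIK, hbK⟩ := exists_prime_ideal_notMem I' (a := b) (by
    rintro ⟨x, hx, hxb⟩
    exact hx (hIJ hxb))
  refine ⟨Clan.ofPrimeIdeals J K hJ hK fun x hx y hy => ?_, Or.inl haJ, Or.inr hbK⟩
  by_contra hxy
  exact hy (hIK ⟨x, hx, hxy⟩)

theorem exists_clan_of_not_le {a b : D} (h : ¬ a ≤ b) :
    ∃ Γ : Clan D, a ∈ Γ.carrier ∧ b ∉ Γ.carrier := by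
  obtain ⟨J, hJ, hbJ, haJ⟩ := exists_prime_ideal_notMem (Ideal.principal b) (a := a) h
  refine ⟨Clan.ofPrimeIdeals J J hJ hJ fun x hx y hy => contact_of_notMem_prime J hJ hx hy,
    Or.inl haJ, ?_⟩
  rintro (h | h) <;> exact h (hbJ (Ideal.mem_principal.2 le_rfl))

end ClanExistence

section ClanSpace

variable {D : Type*} [DistribLattice D] [BoundedOrder D] [EDCLattice D]

theorem clansOf_subset_iff {a b : D} : clansOf a ⊆ clansOf b ↔ a ≤ b := by
  refine ⟨fun h => ?_, fun h Γ hΓ => Γ.mem_of_le _ _ hΓ h⟩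
  by_contra hab
  obtain ⟨Γ, ha, hb⟩ := exists_clan_of_not_le hab
  exact hb (h ha)

theorem clansOf_injective : Function.Injective (clansOf : D → Set (Clan D)) := fun _ _ h =>
  le_antisymm (clansOf_subset_iff.1 h.subset) (clansOf_subset_iff.1 h.symm.subset)

theorem clansOf_top : clansOf (⊤ : D) = univ := eq_univ_of_forall fun Γ => Γ.top_mem

theorem clansOf_bot : clansOf (⊥ : D) = ∅ := eq_empty_of_forall_notMem fun Γ => Γ.bot_notMem

theorem clansOf_inter_nonempty {a b : D} :
    (clansOf a ∩ clansOf b).Nonempty ↔ EDCLattice.C a b :=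
  ⟨fun ⟨Γ, ha, hb⟩ => Γ.contact _ _ ha hb, fun h => exists_clan_of_contact h⟩

theorem isClosed_iff_eq_iInter_clansOf {F : Set (Clan D)} :
    IsClosed F ↔ ∃ A : Set D, F = ⋂ a ∈ A, clansOf a := by
  rw [← isOpen_compl_iff]
  change Fᶜᶜ ∈ {F : Set (Clan D) | ∃ A : Set D, F = ⋂ a ∈ A, clansOf a} ↔ _
  rw [compl_compl, mem_ofPred_eq]

theorem isClosed_clansOf (a : D) : IsClosed (clansOf a) :=
  isClosed_iff_eq_iInter_clansOf.2 ⟨{a}, by simp⟩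

theorem exists_clansOf_of_notMem {F : Set (Clan D)} (hF : IsClosed F) {Γ : Clan D} (hΓ : Γ ∉ F) :
    ∃ a : D, F ⊆ clansOf a ∧ Γ ∉ clansOf a := by
  obtain ⟨A, rfl⟩ := isClosed_iff_eq_iInter_clansOf.1 hF
  simp only [mem_iInter, not_forall] at hΓ
  obtain ⟨a, ha, hΓa⟩ := hΓ
  exact ⟨a, biInter_subset_of_mem ha, hΓa⟩

/-- The clan of all `a` such that an ultrafilter contains `clansOf a`. -/
def Clan.ofUltrafilter (U : Ultrafilter (Clan D)) : Clan D where
  carrier := {a | clansOf a ∈ U}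
  top_mem := by
    rw [mem_ofPred_eq, clansOf_top]
    exact Filter.univ_mem
  bot_notMem := by simp [clansOf_bot]
  mem_of_le a b ha hab := Filter.mem_of_superset ha (clansOf_subset_iff.2 hab)
  mem_or_mem a b hab := by
    simpa only [mem_ofPred_eq, clansOf_sup, Ultrafilter.union_mem_iff] using hab
  contact a b ha hb := clansOf_inter_nonempty.1 (U.nonempty_of_mem (Filter.inter_mem ha hb))

instance Clan.compactSpace : CompactSpace (Clan D) := by
  refine ⟨isCompact_iff_ultrafilter_le_nhds.2 fun U _ => ⟨Clan.ofUltrafilter U, mem_univ _, ?_⟩⟩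
  rw [(nhds_basis_opens _).ge_iff]
  rintro V ⟨hΓV, hV⟩
  obtain ⟨a, hVa, hΓa⟩ := exists_clansOf_of_notMem hV.isClosed_compl (fun h => h hΓV)
  exact Filter.mem_of_superset (Ultrafilter.compl_mem_iff_notMem.2 hΓa) (compl_subset_comm.1 hVa)

instance Clan.t0Space : T0Space (Clan D) := by
  refine ⟨fun Γ Δ h => Clan.ext (Set.ext fun a => ?_)⟩
  exact h.mem_closed_iff (isClosed_clansOf a)

theorem isRegularClosed_clansOf (hD : ExtUnderlap D) (a : D) : IsRegularClosed (clansOf a) := by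
  refine subset_antisymm (closure_minimal interior_subset (isClosed_clansOf a)) fun Γ hΓ => ?_
  by_contra hn
  obtain ⟨c, hc, hΓc⟩ := exists_clansOf_of_notMem isClosed_closure hn
  obtain ⟨b, hab, hcb⟩ := hD a c fun h => hΓc (Γ.mem_of_le _ _ hΓ h)
  obtain ⟨Δ, -, hΔ⟩ := exists_clan_of_not_le fun h => hcb (top_le_iff.1 h)
  refine hΔ (Δ.mem_of_le _ _ (hc (subset_closure ?_)) le_sup_left)
  refine mem_interior.2 ⟨(clansOf b)ᶜ, fun Θ hΘ => ?_, (isClosed_clansOf b).isOpen_compl,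
    fun h => hΔ (Δ.mem_of_le _ _ h le_sup_right)⟩
  exact (Θ.mem_or_mem a b (hab ▸ Θ.top_mem)).resolve_right hΘ

theorem isSemiregular_clan (hD : ExtUnderlap D) : IsSemiregular (Clan D) := by
  refine ⟨range clansOf, ⟨?_, fun F hF => ?_⟩, ?_⟩
  · rintro _ ⟨a, rfl⟩
    exact isClosed_clansOf a
  · obtain ⟨A, rfl⟩ := isClosed_iff_eq_iInter_clansOf.1 hF
    exact ⟨clansOf '' A, image_subset_range _ _, by rw [sInter_image]⟩
  · rintro _ ⟨a, rfl⟩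
    exact isRegularClosed_clansOf hD a

/-- The regular closed set of all clans that contain `a`. -/
def rcClansOf (hD : ExtUnderlap D) (a : D) : RC (Clan D) :=
  ⟨clansOf a, isRegularClosed_clansOf hD a⟩

variable (hD : ExtUnderlap D)

theorem rcClansOf_le_iff {a b : D} : rcClansOf hD a ≤ rcClansOf hD b ↔ a ≤ b := clansOf_subset_iff

theorem rcClansOf_injective : Function.Injective (rcClansOf hD) := fun _ _ h =>
  clansOf_injective (congrArg RC.carrier h)

theorem rcClansOf_top : rcClansOf hD ⊤ = ⊤ := RC.ext clansOf_top

theorem rcClansOf_bot : rcClansOf hD ⊥ = ⊥ := RC.ext clansOf_bot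

theorem rcClansOf_sup (a b : D) : rcClansOf hD (a ⊔ b) = rcClansOf hD a ⊔ rcClansOf hD b :=
  RC.ext (clansOf_sup a b)

theorem rcClansOf_sup_eq_top_iff {a b : D} :
    rcClansOf hD a ⊔ rcClansOf hD b = ⊤ ↔ a ⊔ b = ⊤ := by
  rw [← rcClansOf_sup, ← rcClansOf_top hD, (rcClansOf_injective hD).eq_iff]

theorem compl_rcClansOf_le_iff {a b : D} : (rcClansOf hD a)ᶜ ≤ rcClansOf hD b ↔ a ⊔ b = ⊤ := by
  rw [← rcClansOf_sup_eq_top_iff hD, ← codisjoint_iff, codisjoint_iff_compl_le_right]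

theorem contact_rcClansOf_iff {a b : D} :
    EDCLattice.C (rcClansOf hD a) (rcClansOf hD b) ↔ EDCLattice.C a b :=
  clansOf_inter_nonempty

theorem exists_rcClansOf_of_notMem (α : RC (Clan D)) {Γ : Clan D} (hΓ : Γ ∉ α.carrier) :
    ∃ a : D, α ≤ rcClansOf hD a ∧ a ∉ Γ.carrier :=
  exists_clansOf_of_notMem α.regular.isClosed hΓ

theorem exists_compl_notMem_of_mem_interior {a : D} {Γ : Clan D} (h : Γ ∈ interior (clansOf a)) :
    ∃ b, a ⊔ b = ⊤ ∧ b ∉ Γ.carrier := by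
  obtain ⟨b, hb, hΓb⟩ := exists_clansOf_of_notMem isOpen_interior.isClosed_compl (fun h' => h' h)
  refine ⟨b, clansOf_injective ?_, hΓb⟩
  rw [clansOf_sup, clansOf_top, eq_univ_iff_forall]
  intro Δ
  by_cases hΔ : Δ ∈ clansOf a
  · exact Or.inl hΔ
  · exact Or.inr (hb fun h' => hΔ (interior_subset h'))

theorem rcClansOf_inf (a b : D) : rcClansOf hD (a ⊓ b) = rcClansOf hD a ⊓ rcClansOf hD b := by
  refine le_antisymm (le_inf ((rcClansOf_le_iff hD).2 inf_le_left)
    ((rcClansOf_le_iff hD).2 inf_le_right)) ?_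
  refine closure_minimal (t := clansOf (a ⊓ b)) (fun Γ hΓ => ?_) (isClosed_clansOf _)
  obtain ⟨p, hp, hΓp⟩ := exists_compl_notMem_of_mem_interior (interior_mono inter_subset_left hΓ)
  obtain ⟨q, hq, hΓq⟩ := exists_compl_notMem_of_mem_interior (interior_mono inter_subset_right hΓ)
  have h : a ⊓ b ⊔ (p ⊔ q) = ⊤ := by
    rw [sup_inf_right, ← sup_assoc, hp, sup_comm p q, ← sup_assoc, hq, top_sup_eq, top_sup_eq,
      top_inf_eq]
  exact (Γ.mem_or_mem _ _ (h ▸ Γ.top_mem)).resolve_right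
    fun h => (Γ.mem_or_mem _ _ h).elim hΓp hΓq

/-- Regular closed sets that are not in contact are separated by elements of `D`. -/
theorem exists_not_contact_of_not_contact {α β : RC (Clan D)} (h : ¬ EDCLattice.C α β) :
    ∃ a b : D, α ≤ rcClansOf hD a ∧ β ≤ rcClansOf hD b ∧ ¬ EDCLattice.C a b := by
  let ι := {p : D × D // α ≤ rcClansOf hD p.1 ∧ β ≤ rcClansOf hD p.2}
  have : Nonempty ι := ⟨⟨(⊤, ⊤), by simp [rcClansOf_top]⟩⟩
  obtain ⟨⟨⟨a, b⟩, ha, hb⟩, hab⟩ := isCompact_univ.elim_directed_family_closed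
    (fun p : ι => clansOf p.1.1 ∩ clansOf p.1.2)
    (fun p => (isClosed_clansOf _).inter (isClosed_clansOf _)) (by
      rw [univ_inter, eq_empty_iff_forall_notMem]
      intro Γ hΓ
      rw [mem_iInter] at hΓ
      refine h ⟨Γ, ?_, ?_⟩ <;> by_contra hn
      · obtain ⟨a, ha, hΓa⟩ := exists_rcClansOf_of_notMem hD α hn
        exact hΓa (hΓ ⟨(a, ⊤), ha, by simp [rcClansOf_top]⟩).1
      · obtain ⟨b, hb, hΓb⟩ := exists_rcClansOf_of_notMem hD β hn
        exact hΓb (hΓ ⟨(⊤, b), by simp [rcClansOf_top], hb⟩).2) (by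
      rintro ⟨⟨a, b⟩, ha, hb⟩ ⟨⟨c, d⟩, hc, hd⟩
      refine ⟨⟨(a ⊓ c, b ⊓ d), ?_, ?_⟩, ?_, ?_⟩
      · rw [rcClansOf_inf]
        exact le_inf ha hc
      · rw [rcClansOf_inf]
        exact le_inf hb hd
      · exact inter_subset_inter (clansOf_subset_iff.2 inf_le_left)
          (clansOf_subset_iff.2 inf_le_left)
      · exact inter_subset_inter (clansOf_subset_iff.2 inf_le_right)
          (clansOf_subset_iff.2 inf_le_right))
  refine ⟨a, b, ha, hb, fun hC => ?_⟩
  rw [univ_inter] at hab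
  exact (clansOf_inter_nonempty.2 hC).ne_empty hab

end ClanSpace

section Embedding

variable {D : Type*} [DistribLattice D] [BoundedOrder D] [EDCLattice D]

theorem ll_of_not_contact {a b c : D} (hbc : b ⊔ c = ⊤) (h : ¬ EDCLattice.C a c) :
    EDCLattice.ll a b := by
  refine EDCLattice.Mll2 c a b (fun h' => h (EDCLattice.C4 _ _ h')) ?_
  rw [sup_comm, hbc]
  exact EDCLattice.ll4 _ _ _ _ le_top EDCLattice.ll2 le_rfl

theorem not_dualContact_of_not_contact {a b c d : D} (hac : a ⊔ c = ⊤) (hbd : b ⊔ d = ⊤)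
    (h : ¬ EDCLattice.C c d) : ¬ EDCLattice.dC a b := fun hab =>
  h (EDCLattice.MdC2 a b d c (fun h' => (EDCLattice.dC1 _ _ h').2 hbd) hab
    fun h' => (EDCLattice.dC1 _ _ h').1 hac)

theorem ll_rcClansOf_iff (hD : IsURich D) {a b : D} :
    EDCLattice.ll (rcClansOf hD.extUnderlap a) (rcClansOf hD.extUnderlap b) ↔
      EDCLattice.ll a b := by
  have hO := hD.extUnderlap
  constructor
  · intro h
    obtain ⟨a', c, ha, hc, hac⟩ := exists_not_contact_of_not_contact hO h
    exact ll_of_not_contact ((compl_rcClansOf_le_iff hO).1 hc)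
      fun h' => hac (EDCLattice.C2 _ _ _ _ h' ((rcClansOf_le_iff hO).1 ha) le_rfl)
  · intro h h'
    obtain ⟨c, hbc, hac⟩ := hD.uRichLL a b h
    exact hac ((contact_rcClansOf_iff hO).1
      (EDCLattice.C2 _ _ _ _ h' le_rfl ((compl_rcClansOf_le_iff hO).2 hbc)))

theorem dualContact_rcClansOf_iff (hD : IsURich D) {a b : D} :
    EDCLattice.dC (rcClansOf hD.extUnderlap a) (rcClansOf hD.extUnderlap b) ↔
      EDCLattice.dC a b := by
  have hO := hD.extUnderlap
  rw [← not_iff_not]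
  constructor
  · intro h
    obtain ⟨c, d, hc, hd, hcd⟩ := exists_not_contact_of_not_contact hO h
    exact not_dualContact_of_not_contact ((compl_rcClansOf_le_iff hO).1 hc)
      ((compl_rcClansOf_le_iff hO).1 hd) hcd
  · intro h h'
    obtain ⟨c, d, hac, hbd, hcd⟩ := hD.uRichDC a b h
    exact hcd ((contact_rcClansOf_iff hO).1 (EDCLattice.C2 _ _ _ _ h'
      ((compl_rcClansOf_le_iff hO).2 hac) ((compl_rcClansOf_le_iff hO).2 hbd)))

/-- The embedding of a U-rich EDC-lattice into the regular closed sets of its clan space. -/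
def clanEmbedding (hD : IsURich D) : EDCEmbedding D (RC (Clan D)) where
  toFun := rcClansOf hD.extUnderlap
  map_sup' := rcClansOf_sup _
  map_inf' := rcClansOf_inf _
  map_top' := rcClansOf_top _
  map_bot' := rcClansOf_bot _
  injective' := rcClansOf_injective _
  contact_iff' _ _ := contact_rcClansOf_iff _
  dualContact_iff' _ _ := dualContact_rcClansOf_iff hD
  ll_iff' _ _ := ll_rcClansOf_iff hD

variable (hO : ExtUnderlap D)

theorem exists_rcClansOf_ne_top {α : RC (Clan D)} (hα : α ≠ ⊤) :
    ∃ a : D, α ≤ rcClansOf hO a ∧ a ≠ ⊤ := by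
  obtain ⟨Γ, hΓ⟩ : ∃ Γ, Γ ∉ α.carrier := by
    by_contra! h
    exact hα (RC.ext (eq_univ_of_forall h))
  obtain ⟨a, ha, hΓa⟩ := exists_rcClansOf_of_notMem hO α hΓ
  refine ⟨a, ha, ?_⟩
  rintro rfl
  exact hΓa Γ.top_mem

theorem clanEmbedding_isDuallyDense (hD : IsURich D) : (clanEmbedding hD).IsDuallyDense := by
  intro α hα
  obtain ⟨a, ha, hne⟩ := exists_rcClansOf_ne_top hD.extUnderlap hα
  exact ⟨a, ha, fun h =>
    hne (rcClansOf_injective hD.extUnderlap (h.trans (rcClansOf_top hD.extUnderlap).symm))⟩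

theorem clanEmbedding_isCSeparable (hD : IsURich D) : (clanEmbedding hD).IsCSeparable := by
  have hO := hD.extUnderlap
  have compl_le {α β : RC (Clan D)} (h : αᶜ ≤ β) : α ⊔ β = ⊤ :=
    codisjoint_iff.1 (codisjoint_iff_compl_le_right.2 h)
  refine ⟨fun α β h => ?_, fun α β h => ?_, fun α β h => ?_⟩ <;>
    obtain ⟨a, b, ha, hb, hab⟩ := exists_not_contact_of_not_contact hO h <;>
    have hab' := mt (contact_rcClansOf_iff hO).1 hab
  · exact ⟨a, b, ha, hb, hab'⟩
  · exact ⟨a, b, compl_le ha, compl_le hb, hab'⟩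
  · exact ⟨a, b, ha, compl_le hb, hab'⟩

theorem rcClansOf_ne_bot {b : D} (hb : b ≠ ⊥) : rcClansOf hO b ≠ ⊥ := fun h =>
  hb (rcClansOf_injective _ (h.trans (rcClansOf_bot _).symm))

theorem ne_bot_of_le_rcClansOf {β : RC (Clan D)} {b : D} (hβ : β ≠ ⊥) (h : β ≤ rcClansOf hO b) :
    b ≠ ⊥ := by
  rintro rfl
  rw [rcClansOf_bot] at h
  exact hβ (le_bot_iff.1 h)

theorem sup_eq_top_of_le_rcClansOf {α β : RC (Clan D)} {a b : D} (h : α ⊔ β = ⊤)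
    (ha : α ≤ rcClansOf hO a) (hb : β ≤ rcClansOf hO b) : a ⊔ b = ⊤ := by
  rw [← rcClansOf_sup_eq_top_iff hO, ← top_le_iff, ← h]
  exact sup_le_sup ha hb

theorem exists_not_contact_rcClansOf {a : D} {β : RC (Clan D)}
    (h : ¬ EDCLattice.C (rcClansOf hO a) β) :
    ∃ b : D, β ≤ rcClansOf hO b ∧ ¬ EDCLattice.C a b := by
  obtain ⟨a', b, ha, hb, hab⟩ := exists_not_contact_of_not_contact hO h
  exact ⟨b, hb, fun h' => hab (EDCLattice.C2 _ _ _ _ h' ((rcClansOf_le_iff hO).1 ha) le_rfl)⟩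

theorem not_contact_of_le_rcClansOf {α β : RC (Clan D)} {a b : D} (h : ¬ EDCLattice.C a b)
    (ha : α ≤ rcClansOf hO a) (hb : β ≤ rcClansOf hO b) : ¬ EDCLattice.C α β := fun h' =>
  h ((contact_rcClansOf_iff hO).1 (EDCLattice.C2 _ _ _ _ h' ha hb))

theorem extC_iff (hO : ExtUnderlap D) : ExtC D ↔ ExtC (RC (Clan D)) := by
  constructor
  · intro h α hα
    obtain ⟨a, ha, hne⟩ := exists_rcClansOf_ne_top hO hα
    obtain ⟨b, hb, hab⟩ := h a hne
    exact ⟨rcClansOf hO b, rcClansOf_ne_bot hO hb, not_contact_of_le_rcClansOf hO hab ha le_rfl⟩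
  · intro h a ha
    obtain ⟨β, hβ, hC⟩ := h (rcClansOf hO a) fun h =>
      ha (rcClansOf_injective _ (h.trans (rcClansOf_top _).symm))
    obtain ⟨b, hb, hab⟩ := exists_not_contact_rcClansOf hO hC
    exact ⟨b, ne_bot_of_le_rcClansOf hO hβ hb, hab⟩

theorem conC_iff (hO : ExtUnderlap D) : ConC D ↔ ConC (RC (Clan D)) := by
  constructor
  · intro h α β hα hβ hαβ
    by_contra hn
    obtain ⟨a, b, ha, hb, hab⟩ := exists_not_contact_of_not_contact hO hn
    exact hab (h a b (ne_bot_of_le_rcClansOf hO hα ha) (ne_bot_of_le_rcClansOf hO hβ hb)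
      (sup_eq_top_of_le_rcClansOf hO hαβ ha hb))
  · intro h a b ha hb hab
    exact (contact_rcClansOf_iff hO).1 (h _ _ (rcClansOf_ne_bot hO ha) (rcClansOf_ne_bot hO hb)
      ((rcClansOf_sup_eq_top_iff hO).2 hab))

theorem nor1_iff (hO : ExtUnderlap D) : Nor1 D ↔ Nor1 (RC (Clan D)) := by
  constructor
  · intro h α β hαβ
    obtain ⟨a, b, ha, hb, hab⟩ := exists_not_contact_of_not_contact hO hαβ
    obtain ⟨c, d, hcd, hac, hbd⟩ := h a b hab
    exact ⟨rcClansOf hO c, rcClansOf hO d, (rcClansOf_sup_eq_top_iff hO).2 hcd,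
      not_contact_of_le_rcClansOf hO hac ha le_rfl, not_contact_of_le_rcClansOf hO hbd hb le_rfl⟩
  · intro h a b hab
    obtain ⟨γ, δ, hγδ, hγ, hδ⟩ := h _ _ (mt (contact_rcClansOf_iff hO).1 hab)
    obtain ⟨c, hc, hac⟩ := exists_not_contact_rcClansOf hO hγ
    obtain ⟨d, hd, hbd⟩ := exists_not_contact_rcClansOf hO hδ
    exact ⟨c, d, sup_eq_top_of_le_rcClansOf hO hγδ hc hd, hac, hbd⟩

theorem isWeaklyRegular_clan (hO : ExtUnderlap D) (h : ExtC D) : IsWeaklyRegular (Clan D) := by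
  refine ⟨isSemiregular_clan hO, fun U hU ⟨Γ, hΓ⟩ => ?_⟩
  obtain ⟨a, hUa, hΓa⟩ := exists_clansOf_of_notMem hU.isClosed_compl (fun h => h hΓ)
  obtain ⟨b, hb, hab⟩ := h a (by rintro rfl; exact hΓa Γ.top_mem)
  have hreg : closure (interior (clansOf b)) = clansOf b := isRegularClosed_clansOf hO b
  refine ⟨interior (clansOf b), isOpen_interior, ?_, ?_⟩
  · rw [← closure_nonempty_iff, hreg, nonempty_iff_ne_empty, ← clansOf_bot]
    exact clansOf_injective.ne hb
  · rw [hreg]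
    intro Δ hΔ
    by_contra hΔU
    exact hab (Δ.contact _ _ (hUa hΔU) hΔ)

end Embedding

section RegularClosedSpaces

variable {X : Type*} [TopologicalSpace X]

theorem preconnectedSpace_of_conC (h : ConC (RC X)) : PreconnectedSpace X := by
  refine preconnectedSpace_iff_clopen.2 fun s hs => ?_
  by_contra! hn
  have hreg {t : Set X} (ht : IsClopen t) : IsRegularClosed t := by
    rw [IsRegularClosed, ht.isOpen.interior_eq, ht.isClosed.closure_eq]
  obtain ⟨x, hx, hx'⟩ := h ⟨s, hreg hs⟩ ⟨sᶜ, hreg hs.compl⟩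
    (fun h => hn.1.ne_empty (congrArg RC.carrier h))
    (fun h => hn.2 (compl_empty_iff.1 (congrArg RC.carrier h)))
    (RC.ext (union_compl_self s))
  exact hx' hx

theorem isKappaNormal_of_nor1 (h : Nor1 (RC X)) : IsKappaNormal X := by
  intro s t hs ht hst
  obtain ⟨γ, δ, hγδ, hsγ, htδ⟩ := h ⟨s, hs⟩ ⟨t, ht⟩
    (fun ⟨_, hx, hx'⟩ => disjoint_left.1 hst hx hx')
  refine ⟨γ.carrierᶜ, δ.carrierᶜ, γ.regular.isClosed.isOpen_compl, δ.regular.isClosed.isOpen_compl,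
    fun x hx hx' => hsγ ⟨x, hx, hx'⟩, fun x hx hx' => htδ ⟨x, hx, hx'⟩, ?_⟩
  rw [disjoint_left]
  intro x hx hx'
  have hmem : x ∈ (γ ⊔ δ).carrier := hγδ ▸ mem_univ x
  exact hmem.elim hx hx'

end RegularClosedSpaces

end Mereotopology

/-- For a U-rich EDC-lattice `D`, the space of clans of `D` is compact, semiregular and T0, and
`a ↦ {Γ | a ∈ Γ}` is a dually dense C-separable embedding of `D` into the contact algebra of its
regular closed sets; the axioms (Ext C), (Con C) and (Nor 1) transfer, and make the space weakly
regular, connected and κ-normal respectively. -/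
theorem mainTheorem8 {D : Type*} [DistribLattice D] [BoundedOrder D] [EDCLattice D]
    (hD : IsURich D) :
    CompactSpace (Clan D) ∧ IsSemiregular (Clan D) ∧ T0Space (Clan D) ∧
    ∃ h : EDCEmbedding D (RC (Clan D)),
      (∀ a : D, (h a).carrier = {Γ : Clan D | a ∈ Γ.carrier}) ∧
      h.IsDuallyDense ∧ h.IsCSeparable ∧
      ((ExtC D ↔ ExtC (RC (Clan D))) ∧ (ExtC D → IsWeaklyRegular (Clan D))) ∧
      ((ConC D ↔ ConC (RC (Clan D))) ∧ (ConC D → PreconnectedSpace (Clan D))) ∧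
      ((Nor1 D ↔ Nor1 (RC (Clan D))) ∧ (Nor1 D → IsKappaNormal (Clan D))) := by
  have hO := hD.extUnderlap
  exact ⟨inferInstance, isSemiregular_clan hO, inferInstance, clanEmbedding hD, fun _ => rfl,
    clanEmbedding_isDuallyDense hD, clanEmbedding_isCSeparable hD,
    ⟨extC_iff hO, isWeaklyRegular_clan hO⟩,
    ⟨conC_iff hO, fun h => preconnectedSpace_of_conC ((conC_iff hO).1 h)⟩,
    ⟨nor1_iff hO, fun h => isKappaNormal_of_nor1 ((nor1_iff hO).1 h)⟩⟩
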